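/- Let $M$ be a nonempty compact smooth Riemannian manifold without boundary, of dimension $d\ge 1$, with Riemannian distance (if $M$ is not connected, points of different components are at infinite distance), and let $\nu$ be its Riemannian volume, normalized to a probability measure. Let a group $\Gamma$ with a finite symmetric generating set $S$ act on $M$ by Lipschitz homeomorphisms. For $t\ge 1$, let $\mathcal G_t(\Gamma\curvearrowright M)$ denote any graph obtained as follows. Take a subset $Y\subset M$ that is $\frac1t$-separated (distinct points are at distance at least $\frac1t$) and $\frac1t$-dense (every point of $M$ is at distance at most $\frac1t$ from $Y$), and a partition $\mathcal P=\{R_y\}_{y\in Y}$ of $M$ into finitely many distinct measurable regions, indexed by $Y$, such that \[ B\big(y,\tfrac1{2t}\big)\subseteq R_y\subseteq \overline B\big(y,\tfrac1t\big)\qquad (y\in Y) \] (for example a Voronoi tessellation for $Y$). The vertices of $\mathcal G_t(\Gamma\curvearrowright M)$ are the regions, and two distinct regions $R,R'$ are joined by an edge if there is $s\in S$ with $\nu((s\cdot R)\cap R')>0$ or $\nu((s\cdot R')\cap R)>0$. Then there is a constant $C>0$, depending only on $M$ (and not on $\Gamma$, $S$ or the action), such that for every integer $N\ge 1$ there is a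 real number $t\ge 1$ for which such graphs exist and each of them satisfies \[ \frac NC\le |\mathcal G_t(\Gamma\curvearrowright M)|\le CN, \] where $|\mathcal G|$ denotes the number of vertices of $\mathcal G$. -/

import Mathlib

open MeasureTheory Set
open scoped ENNReal NNReal Manifold ContDiff Bundle

/-- A subset `Y` that is `r`-separated (distinct points are at distance at least `r`) and
`r`-dense (each point of the space is at distance at most `r` from `Y`). -/
structure IsSeparatedDense {X : Type*} [EMetricSpace X] (r : ℝ≥0∞) (Y : Set X) : Prop where
  separated : ∀ y ∈ Y, ∀ y' ∈ Y, y ≠ y' → r ≤ edist y y'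
  dense : ∀ x : X, ∃ y ∈ Y, edist x y ≤ r

/-- A partition of `X` into finitely many (nonempty, pairwise disjoint) measurable regions. -/
structure IsMeasurablePartition {X : Type*} [MeasurableSpace X] (P : Set (Set X)) : Prop where
  isPartition : Setoid.IsPartition P
  finite : P.Finite
  measurable : ∀ R ∈ P, MeasurableSet R

/-- The graph approximating an action on `(X, ν)` with respect to the set of regions `P`: its
vertices are the regions, and distinct regions `R`, `R'` are joined by an edge when
`ν ((s • R) ∩ R') > 0` for some `s ∈ S` (the relation is symmetrized and loops are dropped). -/
def approximatingGraph {Γ X : Type*} [Group Γ] [MulAction Γ X] [MeasurableSpace X]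
    (S : Finset Γ) (ν : Measure X) (P : Set (Set X)) : SimpleGraph P :=
  SimpleGraph.fromRel fun R R' : P =>
    ∃ s ∈ S, 0 < ν (((fun x : X => s • x) '' (R : Set X)) ∩ (R' : Set X))

/-- The regions of `P` are in one-to-one correspondence with a `1/t`-dense, `1/t`-separated set `Y`
of centres; the region of `y` contains the open ball of radius `1/(2t)` about `y` and lies in the
closed ball of radius `1/t` about `y`. Voronoi tessellations of `Y`, with any measurable rule for
the ties, are of this form. -/
structure IsPartitionAtScale {X : Type*} [EMetricSpace X] [MeasurableSpace X]
    (t : ℝ) (P : Set (Set X)) : Prop where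
  measurablePartition : IsMeasurablePartition P
  centred : ∃ (Y : Set X) (cell : X → Set X),
    IsSeparatedDense (ENNReal.ofReal (1 / t)) Y ∧ BijOn cell Y P ∧
    ∀ y ∈ Y, (∀ x, edist x y < ENNReal.ofReal (1 / (2 * t)) → x ∈ cell y) ∧
      ∀ x ∈ cell y, edist x y ≤ ENNReal.ofReal (1 / t)

/-- The Riemannian volume of a `d`-dimensional compact Riemannian manifold, normalized to a
probability measure. The Riemannian volume is, up to a constant that depends on `d` only and
disappears in the normalization, the `d`-dimensional Hausdorff measure of the Riemannian
distance. -/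
noncomputable def normalizedVolume (d : ℕ) (M : Type*) [EMetricSpace M] [MeasurableSpace M]
    [BorelSpace M] : Measure M :=
  (Measure.hausdorffMeasure (d : ℝ) (univ : Set M))⁻¹ • Measure.hausdorffMeasure (d : ℝ)

/-- The graphs `𝒢_t(Γ ↷ M)`: the graphs that approximate the action with respect to a partition
at scale `t`. (They depend on the choice of the partition.) -/
structure ScaleGraph {Γ M : Type*} [Group Γ] [EMetricSpace M] [MeasurableSpace M]
    [MulAction Γ M] (S : Finset Γ) (ν : Measure M) (t : ℝ) where
  regions : Set (Set M)
  isPartitionAtScale : IsPartitionAtScale t regions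
  graph : SimpleGraph regions
  graph_eq : graph = approximatingGraph S ν regions

/-- The number of vertices. -/
noncomputable def ScaleGraph.order {Γ M : Type*} [Group Γ] [EMetricSpace M] [MeasurableSpace M]
    [MulAction Γ M] {S : Finset Γ} {ν : Measure M} {t : ℝ} (G : ScaleGraph S ν t) : ℕ :=
  Nat.card G.regions

/-! The action plays no role in the vertex count: a graph at scale `t` has as many vertices as its
set `Y` of centres has points, so it suffices that `|Y|` is comparable to `t ^ d` uniformly in `Y`;
then `t = N ^ (1/d)` works. Charts are locally bi-Lipschitz for the Riemannian distance, which
reduces both bounds to Euclidean volume comparison. Upper bound (`exists_card_le_of_separated`):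
finitely many chart domains cover `M`, and in each one the images of separated points are centres of
disjoint balls inside a bounded ball. Lower bound (`exists_le_card_of_dense`): near a single point,
the images of the centres must cover a fixed ball by balls of radius `O(1/t)`. Existence of the
graphs comes from a Voronoi tessellation of a maximal separated set (`exists_isPartitionAtScale`).
-/

/-! ### Charts are locally bi-Lipschitz -/

section Charts

open Filter Topology Metric Bundle Manifold

variable {E : Type*} [NormedAddCommGroup E] [NormedSpace ℝ E]
  {H : Type*} [TopologicalSpace H] (I : ModelWithCorners ℝ E H)
  {M : Type*} [PseudoEMetricSpace M] [ChartedSpace H M]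
  [RiemannianBundle (fun x : M => TangentSpace I x)]
  [IsManifold I 1 M] [IsContinuousRiemannianBundle E (fun x : M => TangentSpace I x)]

attribute [local instance] normedAddCommGroupTangentSpaceVectorSpace
attribute [local instance] normedSpaceTangentSpaceVectorSpace

/-- Extended charts have locally Lipschitz inverses for the Riemannian distance. -/
lemma exists_nhds_riemannianEDist_le_edist_extChartAt (x : M) :
    ∃ C : ℝ≥0, ∃ U ∈ 𝓝 x, ∀ y ∈ U, ∀ z ∈ U,
      riemannianEDist I y z ≤ C * edist (extChartAt I x y) (extChartAt I x z) := by
  rcases eventually_enorm_mfderivWithin_symm_extChartAt_lt I x with ⟨C, C_pos, hC⟩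
  refine ⟨C, ?_⟩
  obtain ⟨r, r_pos, hr⟩ := mem_nhdsWithin_iff.1
    (inter_mem (extChartAt_target_mem_nhdsWithin x) hC)
  have A : (extChartAt I x) ⁻¹' (ball (extChartAt I x x) r ∩ range I) ∈ 𝓝 x := by
    apply extChartAt_preimage_mem_nhds_of_mem_nhdsWithin (by simp)
    rw [inter_comm]
    exact inter_mem_nhdsWithin _ (ball_mem_nhds _ r_pos)
  refine ⟨_, inter_mem A (chart_source_mem_nhds H x), ?_⟩
  rintro y ⟨hy, h'y⟩ z ⟨hz, h'z⟩
  -- The competitor curve is a straight segment in the chart, pulled back to the manifold. By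
  -- convexity it stays where the derivative of the inverse chart is bounded by `C`.
  let η := ContinuousAffineMap.lineMap (R := ℝ) (extChartAt I x y) (extChartAt I x z)
  set γ := (extChartAt I x).symm ∘ η
  have hη : Icc 0 1 ⊆ ⇑η ⁻¹' (ball (extChartAt I x x) r ∩ range I) := by
    simp only [← image_subset_iff, ContinuousAffineMap.coe_lineMap_eq,
     ← segment_eq_image_lineMap, η]
    exact ((convex_ball _ _).inter I.convex_range).segment_subset hy hz
  have hη' : Icc 0 1 ⊆ ⇑η ⁻¹' (extChartAt I x).target := fun t ht ↦ (hr (hη ht)).1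
  have η_smooth : CMDiff[Icc 0 1] 1 η := by
    apply ContMDiff.contMDiffOn
    rw [contMDiff_iff_contDiff]
    exact ContinuousAffineMap.contDiff _
  have : riemannianEDist I y z ≤ pathELength I γ 0 1 := by
    apply riemannianEDist_le_pathELength _ _ _ zero_le_one
    · exact (contMDiffOn_extChartAt_symm x).comp η_smooth hη'
    · simp [γ, η, ContinuousAffineMap.coe_lineMap_eq, h'y]
    · simp [γ, η, ContinuousAffineMap.coe_lineMap_eq, h'z]
  apply this.trans
  rw [← lintegral_fderiv_lineMap_eq_edist, pathELength_eq_lintegral_mfderivWithin_Icc,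
    ← lintegral_const_mul' _ _ ENNReal.coe_ne_top]
  apply setLIntegral_mono' measurableSet_Icc (fun t ht ↦ ?_)
  have : mfderiv[Icc 0 1] γ t =
      (mfderiv[range I] (extChartAt I x).symm (η t)) ∘L (mfderiv[Icc 0 1] η t) := by
    apply mfderivWithin_comp
    · exact mdifferentiableWithinAt_extChartAt_symm (hη' ht)
    · exact η_smooth.mdifferentiableOn one_ne_zero t ht
    · exact hη'.trans (preimage_mono (extChartAt_target_subset_range x))
    · rw [uniqueMDiffWithinAt_iff_uniqueDiffWithinAt]
      exact uniqueDiffOn_Icc zero_lt_one t ht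
  have : mfderiv[Icc 0 1] γ t 1 =
      (mfderiv[range I] (extChartAt I x).symm (η t)) (mfderiv[Icc 0 1] η t 1) := congr($this 1)
  rw [this]
  apply (ContinuousLinearMap.le_opENorm _ _).trans
  gcongr
  · exact (hr (hη ht)).2.le
  · simp only [mfderivWithin_eq_fderivWithin]
    exact le_of_eq rfl

/-- Extended charts are locally Lipschitz for the Riemannian distance. -/
lemma exists_nhds_edist_extChartAt_le_edist [IsRiemannianManifold I M] (x : M) :
    ∃ C : ℝ≥0, ∃ U ∈ 𝓝 x, ∀ y ∈ U, ∀ z ∈ U,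
      edist (extChartAt I x y) (extChartAt I x z) ≤ C * edist y z := by
  rcases eventually_enorm_mfderiv_extChartAt_lt I x with ⟨C, C_pos, hC⟩
  obtain ⟨r, r_pos, hr⟩ := EMetric.mem_nhds_iff.1
    (inter_mem hC (chart_source_mem_nhds H x))
  -- Points of the quarter ball are less than `r / 2` apart, and a curve of length less than `r / 2`
  -- starting there stays in the ball of radius `r`, where the chart is controlled.
  have hr_pos : 0 < r / 2 / 2 := ENNReal.half_pos (ENNReal.half_pos r_pos.ne').ne'
  refine ⟨C, eball x (r / 2 / 2), eball_mem_nhds x hr_pos, fun y hy z hz ↦ ?_⟩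
  rw [mem_eball] at hy hz
  have hyz : edist y z < r / 2 := by
    calc edist y z ≤ edist y x + edist z x := edist_triangle_right _ _ _
      _ < r / 2 / 2 + r / 2 / 2 := ENNReal.add_lt_add hy hz
      _ = r / 2 := ENNReal.add_halves _
  -- The distance is an infimum over curves that need not be attained, so the bound is shown for
  -- every `s` slightly above it.
  have key : ∀ s, edist y z < s → s ≤ r / 2 →
      edist (extChartAt I x y) (extChartAt I x z) ≤ C * s := by
    intro s hs hsr
    rw [IsRiemannianManifold.out (I := I) y z] at hs
    rcases exists_lt_of_riemannianEDist_lt hs with ⟨γ, hγ0, hγ1, γ_smooth, hγ⟩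
    have hmem : ∀ t ∈ Icc (0 : ℝ) 1, γ t ∈ eball x r := by
      intro t ht
      have h1 : edist y (γ t) ≤ pathELength I γ 0 1 := by
        rw [IsRiemannianManifold.out (I := I) y (γ t)]
        exact (riemannianEDist_le_pathELength (γ_smooth.mono (Icc_subset_Icc_right ht.2))
          hγ0 rfl ht.1).trans (pathELength_mono le_rfl ht.2)
      rw [mem_eball]
      calc edist (γ t) x ≤ edist y (γ t) + edist y x := edist_triangle_left _ _ _
        _ < r / 2 + r / 2 := by
          refine ENNReal.add_lt_add ((h1.trans_lt hγ).trans_le hsr) (hy.trans_le ?_)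
          exact ENNReal.half_le_self
        _ = r := ENNReal.add_halves r
    let γ' := extChartAt I x ∘ γ
    have hC' : CMDiff[Icc 0 1] 1 γ' :=
      contMDiffOn_extChartAt.comp (I' := I) (t := (chartAt H x).source)
        γ_smooth (fun t' ht' ↦ (hr (hmem t' ht')).2)
    have h0 : extChartAt I x y = γ' 0 := by simp [γ', hγ0]
    have h1 : extChartAt I x z = γ' 1 := by simp [γ', hγ1]
    rw [h0, h1, edist_comm, edist_eq_enorm_sub]
    calc
      ‖γ' 1 - γ' 0‖ₑ
    _ ≤ ∫⁻ t' in Icc 0 1, ‖derivWithin γ' (Icc 0 1) t'‖ₑ := by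
      apply enorm_sub_le_lintegral_derivWithin_Icc_of_contDiffOn_Icc _ zero_le_one
      rwa [← contMDiffOn_iff_contDiffOn]
    _ = ∫⁻ t' in Icc 0 1, ‖mfderiv[Icc 0 1] γ' t' 1‖ₑ := by
      simp_rw [← fderivWithin_derivWithin, mfderivWithin_eq_fderivWithin]
      rfl
    _ ≤ ∫⁻ t' in Icc 0 1, C * ‖mfderiv[Icc 0 1] γ t' 1‖ₑ := by
      apply setLIntegral_mono' measurableSet_Icc (fun t' ht' ↦ ?_)
      have : mfderiv[Icc 0 1] γ' t' =
          (mfderiv% (extChartAt I x) (γ t')) ∘L (mfderiv[Icc 0 1] γ t') := by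
        apply mfderiv_comp_mfderivWithin
        · exact mdifferentiableAt_extChartAt (hr (hmem t' ht')).2
        · exact γ_smooth.mdifferentiableOn one_ne_zero _ ht'
        · rw [uniqueMDiffWithinAt_iff_uniqueDiffWithinAt]
          exact uniqueDiffOn_Icc zero_lt_one _ ht'
      have : mfderiv[Icc 0 1] γ' t' 1 =
          (mfderiv% (extChartAt I x) (γ t')) (mfderiv[Icc 0 1] γ t' 1) :=
        congr($this 1)
      rw [this]
      apply (ContinuousLinearMap.le_opENorm _ _).trans
      gcongr
      exact (hr (hmem t' ht')).1.le
    _ = C * pathELength I γ 0 1 := by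
      rw [lintegral_const_mul' _ _ ENNReal.coe_ne_top,
          pathELength_eq_lintegral_mfderivWithin_Icc]
    _ ≤ C * s := by gcongr
  -- Letting `s` decrease to `edist y z`: a failure of the bound would leave room for an `s`
  -- contradicting `key`.
  by_contra! hcon
  obtain ⟨s, hs, hs'⟩ : ∃ s, edist y z < s ∧ (C : ℝ≥0∞) * s <
      edist (extChartAt I x y) (extChartAt I x z) := by
    have hC0 : (C : ℝ≥0∞) ≠ 0 := by exact_mod_cast C_pos.ne'
    rw [mul_comm, ← ENNReal.lt_div_iff_mul_lt (Or.inl hC0) (Or.inl ENNReal.coe_ne_top)] at hcon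
    obtain ⟨s, h1, h2⟩ := exists_between hcon
    refine ⟨s, h1, ?_⟩
    rwa [mul_comm, ← ENNReal.lt_div_iff_mul_lt (Or.inl hC0) (Or.inl ENNReal.coe_ne_top)]
  refine absurd (key (min s (r / 2)) (lt_min hs hyz) (min_le_right _ _)) (not_le.2 ?_)
  exact lt_of_le_of_lt (by gcongr; exact min_le_left _ _) hs'

end Charts

/-! ### Packing and covering bounds by Euclidean volume -/

section VolumeCounting

open Metric Module

variable {E : Type*} [NormedAddCommGroup E] [NormedSpace ℝ E] [FiniteDimensional ℝ E]

/-- A `δ`-separated subset of a ball of radius `R` has at most `(2 R / δ + 1) ^ dim` points. -/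
lemma card_le_of_separated_of_subset_closedBall {s : Finset E} {a : E} {R δ : ℝ} (hR : 0 ≤ R)
    (hδ : 0 < δ) (hs : ∀ c ∈ s, c ∈ closedBall a R)
    (hsep : ∀ c ∈ s, ∀ c' ∈ s, c ≠ c' → δ ≤ dist c c') :
    (s.card : ℝ) ≤ (2 * R / δ + 1) ^ finrank ℝ E := by
  borelize E
  let μ : Measure E := Measure.addHaar
  have hδ2 : 0 < δ / 2 := half_pos hδ
  have hRδ : 0 < R + δ / 2 := by positivity
  have hdisj : (s : Set E).PairwiseDisjoint fun c => ball c (δ / 2) := by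
    intro c hc c' hc' hcc'
    apply ball_disjoint_ball
    linarith [hsep c hc c' hc' hcc']
  have hsub : (⋃ c ∈ s, ball c (δ / 2)) ⊆ ball a (R + δ / 2) := by
    refine iUnion₂_subset fun c hc => ball_subset_ball' ?_
    linarith [mem_closedBall.1 (hs c hc)]
  have key : (s.card : ℝ≥0∞) * ENNReal.ofReal ((δ / 2) ^ finrank ℝ E) * μ (ball 0 1) ≤
      ENNReal.ofReal ((R + δ / 2) ^ finrank ℝ E) * μ (ball 0 1) :=
    calc
      _ = ∑ c ∈ s, μ (ball c (δ / 2)) := by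
        simp [Measure.addHaar_ball_of_pos μ _ hδ2, mul_assoc]
      _ = μ (⋃ c ∈ s, ball c (δ / 2)) :=
        (measure_biUnion_finset hdisj fun c _ => measurableSet_ball).symm
      _ ≤ μ (ball a (R + δ / 2)) := measure_mono hsub
      _ = _ := Measure.addHaar_ball_of_pos μ _ hRδ
  rw [ENNReal.mul_le_mul_iff_left (measure_ball_pos _ _ zero_lt_one).ne' measure_ball_lt_top.ne,
    ← ENNReal.ofReal_natCast, ← ENNReal.ofReal_mul (by positivity),
    ENNReal.ofReal_le_ofReal_iff (by positivity)] at key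
  rw [← le_div_iff₀ (by positivity), ← div_pow] at key
  refine key.trans_eq ?_
  congr 1
  field_simp

/-- A ball of radius `ρ` covered by `n` balls of radius `ε` satisfies `ρ ^ dim ≤ n ε ^ dim`. -/
lemma pow_finrank_le_card_mul_of_ball_subset {s : Finset E} {a : E} {ρ ε : ℝ} (hρ : 0 < ρ)
    (hε : 0 ≤ ε) (hs : ball a ρ ⊆ ⋃ c ∈ s, closedBall c ε) :
    ρ ^ finrank ℝ E ≤ s.card * ε ^ finrank ℝ E := by
  borelize E
  let μ : Measure E := Measure.addHaar
  have key : ENNReal.ofReal (ρ ^ finrank ℝ E) * μ (ball 0 1) ≤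
      (s.card : ℝ≥0∞) * ENNReal.ofReal (ε ^ finrank ℝ E) * μ (ball 0 1) :=
    calc
      _ = μ (ball a ρ) := (Measure.addHaar_ball_of_pos μ _ hρ).symm
      _ ≤ μ (⋃ c ∈ s, closedBall c ε) := measure_mono hs
      _ ≤ ∑ c ∈ s, μ (closedBall c ε) := measure_biUnion_finset_le _ _
      _ = _ := by simp [Measure.addHaar_closedBall μ _ hε, mul_assoc]
  rwa [ENNReal.mul_le_mul_iff_left (measure_ball_pos _ _ zero_lt_one).ne' measure_ball_lt_top.ne,
    ← ENNReal.ofReal_natCast, ← ENNReal.ofReal_mul (by positivity),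
    ENNReal.ofReal_le_ofReal_iff (by positivity)] at key

variable {X : Type*} [PseudoEMetricSpace X]

/-- The number of points of `1/t`-separated sets contained in a set with a bounded
coordinate whose inverse is Lipschitz is `O(t ^ dim)`. -/
lemma exists_card_le_of_separated_of_edist_le {f : X → E} {U : Set X} {C : ℝ≥0} {a : E} {R : ℝ}
    (hR : 0 ≤ R) (hfU : ∀ x ∈ U, f x ∈ closedBall a R)
    (hf : ∀ y ∈ U, ∀ z ∈ U, edist y z ≤ C * edist (f y) (f z)) :
    ∃ A : ℝ, 0 ≤ A ∧ ∀ t : ℝ, 1 ≤ t → ∀ Y : Finset X, (Y : Set X) ⊆ U →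
      (∀ y ∈ Y, ∀ y' ∈ Y, y ≠ y' → ENNReal.ofReal (1 / t) ≤ edist y y') →
      (Y.card : ℝ) ≤ A * t ^ finrank ℝ E := by
  classical
  -- `C + 1` replaces `C`, which may vanish, so that division is possible.
  have hC1 : (0 : ℝ) < C + 1 := by positivity
  refine ⟨(2 * R * (C + 1) + 1) ^ finrank ℝ E, by positivity, fun t ht Y hYU hY => ?_⟩
  have ht0 : 0 < t := by positivity
  have hsep : ∀ y ∈ Y, ∀ y' ∈ Y, y ≠ y' → 1 / (t * (C + 1)) ≤ dist (f y) (f y') := by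
    intro y hy y' hy' hne
    have h := (hY y hy y' hy' hne).trans (hf y (hYU hy) y' (hYU hy'))
    rw [edist_dist, ← ENNReal.ofReal_coe_nnreal, ← ENNReal.ofReal_mul (by positivity),
      ENNReal.ofReal_le_ofReal_iff (by positivity)] at h
    rw [← div_div, div_le_iff₀ hC1]
    nlinarith [dist_nonneg (x := f y) (y := f y')]
  have hinj : InjOn f Y := by
    intro y hy y' hy' h
    by_contra hne
    have h1 := hsep y hy y' hy' hne
    rw [h, dist_self] at h1
    exact absurd h1 (not_le.2 (by positivity))
  have hcard := card_le_of_separated_of_subset_closedBall (s := Y.image f) (a := a) hR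
    (δ := 1 / (t * (C + 1))) (by positivity)
    (by
      intro c hc
      obtain ⟨y, hy, rfl⟩ := Finset.mem_image.1 hc
      exact hfU y (hYU hy))
    (by
      intro c hc c' hc' hne
      obtain ⟨y, hy, rfl⟩ := Finset.mem_image.1 hc
      obtain ⟨y', hy', rfl⟩ := Finset.mem_image.1 hc'
      exact hsep y hy y' hy' fun h => hne (congrArg f h))
  rw [Finset.card_image_of_injOn hinj] at hcard
  refine hcard.trans ?_
  rw [← mul_pow]
  gcongr
  have : 2 * R / (1 / (t * (C + 1))) = 2 * R * (C + 1) * t := by field_simp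
  rw [this]
  nlinarith

/-- In a compact space which locally has bounded coordinates with Lipschitz inverses,
the number of points of `1/t`-separated sets is `O(t ^ dim)`. -/
lemma exists_card_le_of_separated [CompactSpace X]
    (h : ∀ x : X, ∃ f : X → E, ContinuousAt f x ∧ ∃ C : ℝ≥0, ∃ U ∈ nhds x, ∀ y ∈ U, ∀ z ∈ U,
      edist y z ≤ C * edist (f y) (f z)) :
    ∃ A : ℝ, 0 ≤ A ∧ ∀ t : ℝ, 1 ≤ t → ∀ Y : Finset X,
      (∀ y ∈ Y, ∀ y' ∈ Y, y ≠ y' → ENNReal.ofReal (1 / t) ≤ edist y y') →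
      (Y.card : ℝ) ≤ A * t ^ finrank ℝ E := by
  classical
  suffices H : ∃ A : ℝ, 0 ≤ A ∧ ∀ t : ℝ, 1 ≤ t → ∀ Y : Finset X, (Y : Set X) ⊆ univ →
      (∀ y ∈ Y, ∀ y' ∈ Y, y ≠ y' → ENNReal.ofReal (1 / t) ≤ edist y y') →
      (Y.card : ℝ) ≤ A * t ^ finrank ℝ E by
    simpa using H
  -- An `O(t ^ dim)` bound passes to subsets and to finite unions (constants add), so by compactness
  -- it is enough to have it near each point.
  refine isCompact_univ.induction_on (p := fun s : Set X => ∃ A : ℝ, 0 ≤ A ∧ ∀ t : ℝ, 1 ≤ t →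
      ∀ Y : Finset X, (Y : Set X) ⊆ s →
      (∀ y ∈ Y, ∀ y' ∈ Y, y ≠ y' → ENNReal.ofReal (1 / t) ≤ edist y y') →
      (Y.card : ℝ) ≤ A * t ^ finrank ℝ E) ?_ ?_ ?_ ?_
  · refine ⟨0, le_rfl, fun t _ Y hY _ => ?_⟩
    simp [Finset.coe_eq_empty.1 (subset_empty_iff.1 hY)]
  · rintro s s' hss' ⟨A, hA, H⟩
    exact ⟨A, hA, fun t ht Y hY => H t ht Y (hY.trans hss')⟩
  · rintro s s' ⟨A, hA, H⟩ ⟨A', hA', H'⟩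
    refine ⟨A + A', by positivity, fun t ht Y hY hsep => ?_⟩
    have h1 := H t ht (Y.filter (· ∈ s)) (by simp [subset_def])
      fun y hy y' hy' => hsep y (Finset.mem_of_mem_filter y hy) y' (Finset.mem_of_mem_filter y' hy')
    have h2 := H' t ht (Y.filter (· ∉ s))
      (fun y hy => by
        obtain ⟨hy, hys⟩ := Finset.mem_filter.1 (Finset.mem_coe.1 hy)
        exact (hY hy).resolve_left hys)
      fun y hy y' hy' => hsep y (Finset.mem_of_mem_filter y hy) y' (Finset.mem_of_mem_filter y' hy')
    rw [← Finset.card_filter_add_card_filter_not (s := Y) (· ∈ s), Nat.cast_add, add_mul]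
    exact add_le_add h1 h2
  · intro x _
    obtain ⟨f, hfx, C, U, hU, hf⟩ := h x
    have hV : f ⁻¹' closedBall (f x) 1 ∈ nhds x :=
      hfx.preimage_mem_nhds (closedBall_mem_nhds _ one_pos)
    exact ⟨U ∩ f ⁻¹' closedBall (f x) 1, by simpa using ⟨hU, hV⟩,
      exists_card_le_of_separated_of_edist_le zero_le_one (fun y hy => hy.2)
        fun y hy z hz => hf y hy.1 z hz.1⟩

/-- In a space with a point around which there is an open Lipschitz coordinate, the
number of points of `1/t`-dense sets is at least a constant times `t ^ dim`. -/
lemma exists_le_card_of_dense {f : X → E} {x₀ : X} {U : Set X} {C : ℝ≥0}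
    (hopen : ∀ V ∈ nhds x₀, f '' V ∈ nhds (f x₀)) (hU : U ∈ nhds x₀)
    (hf : ∀ y ∈ U, ∀ z ∈ U, edist (f y) (f z) ≤ C * edist y z) :
    ∃ a : ℝ, 0 < a ∧ ∀ t : ℝ, 1 ≤ t → ∀ Y : Finset X,
      (∀ x : X, ∃ y ∈ Y, edist x y ≤ ENNReal.ofReal (1 / t)) →
      a * t ^ finrank ℝ E ≤ (Y.card : ℝ) := by
  classical
  -- The radius is doubled so that a centre within `1/t < ε` of a point of the `ε`-ball still lies
  -- in `U`.
  obtain ⟨ε, hε, hεU⟩ : ∃ ε : ℝ, 0 < ε ∧ eball x₀ (ENNReal.ofReal (2 * ε)) ⊆ U := by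
    obtain ⟨r, hr, hrU⟩ := EMetric.mem_nhds_iff.1 hU
    obtain ⟨q, hq0, hq⟩ := ENNReal.lt_iff_exists_nnreal_btwn.1 hr
    refine ⟨q / 2, by simpa using hq0, (eball_subset_eball ?_).trans hrU⟩
    rw [mul_div_cancel₀ _ (two_ne_zero' ℝ), ENNReal.ofReal_coe_nnreal]
    exact hq.le
  obtain ⟨ρ, hρ, hρf⟩ := Metric.mem_nhds_iff.1
    (hopen _ (eball_mem_nhds x₀ (ENNReal.ofReal_pos.2 hε)))
  have hC1 : (0 : ℝ) < C + 1 := by positivity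
  refine ⟨min (ε ^ finrank ℝ E) ((ρ / (C + 1)) ^ finrank ℝ E), by positivity,
    fun t ht Y hY => ?_⟩
  have ht0 : 0 < t := by positivity
  -- At coarse scales, centres may leave `U`, but there `(ε * t) ^ dim ≤ 1` and one centre suffices;
  -- this is the first term of the minimum.
  rcases le_or_gt (ε * t) 1 with hεt | hεt
  · have hcard : 1 ≤ Y.card := by
      obtain ⟨y, hy, -⟩ := hY x₀
      exact Finset.card_pos.2 ⟨y, hy⟩
    calc _ ≤ ε ^ finrank ℝ E * t ^ finrank ℝ E := by gcongr; exact min_le_left _ _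
      _ = (ε * t) ^ finrank ℝ E := (mul_pow _ _ _).symm
      _ ≤ 1 := pow_le_one₀ (by positivity) hεt
      _ ≤ Y.card := by exact_mod_cast hcard
  · have hsub : ball (f x₀) ρ ⊆ ⋃ c ∈ Y.image f, closedBall c ((C + 1) / t) := by
      intro p hp
      obtain ⟨x, hx, rfl⟩ := hρf hp
      obtain ⟨y, hy, hxy⟩ := hY x
      rw [mem_eball] at hx
      have hxU : x ∈ U := hεU (by
        rw [mem_eball]
        exact hx.trans_le (ENNReal.ofReal_le_ofReal (by linarith)))
      have hyU : y ∈ U := hεU (by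
        rw [mem_eball]
        calc edist y x₀ ≤ edist x y + edist x x₀ := edist_triangle_left _ _ _
          _ < ENNReal.ofReal ε + ENNReal.ofReal ε := by
            refine ENNReal.add_lt_add (hxy.trans_lt ?_) hx
            rw [ENNReal.ofReal_lt_ofReal_iff hε, div_lt_iff₀ ht0]
            exact hεt
          _ = ENNReal.ofReal (2 * ε) := by rw [← ENNReal.ofReal_add hε.le hε.le, two_mul])
      have h := hf x hxU y hyU
      have h' : edist (f x) (f y) ≤ C * ENNReal.ofReal (1 / t) := h.trans (by gcongr)
      rw [edist_dist, ← ENNReal.ofReal_coe_nnreal, ← ENNReal.ofReal_mul (by positivity),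
        ENNReal.ofReal_le_ofReal_iff (by positivity)] at h'
      refine mem_iUnion₂.2 ⟨f y, Finset.mem_image_of_mem f hy, mem_closedBall.2 (h'.trans ?_)⟩
      rw [mul_one_div]
      gcongr
      linarith
    have h := pow_finrank_le_card_mul_of_ball_subset hρ (by positivity) hsub
    calc _ ≤ (ρ / (C + 1)) ^ finrank ℝ E * t ^ finrank ℝ E := by gcongr; exact min_le_right _ _
      _ = ρ ^ finrank ℝ E / ((C + 1) / t) ^ finrank ℝ E := by
        rw [← mul_pow, ← div_pow]
        congr 1
        field_simp
      _ ≤ (Y.image f).card := by rwa [div_le_iff₀ (by positivity)]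
      _ ≤ Y.card := by exact_mod_cast Finset.card_image_le

end VolumeCounting

/-! ### Separated nets and Voronoi tessellations -/

section Tessellation

variable {X : Type*} [EMetricSpace X]

/-- Compact spaces have finite separated and dense sets at every scale. -/
lemma exists_finite_isSeparatedDense [CompactSpace X] {r : ℝ≥0} (hr : r ≠ 0) :
    ∃ Y : Set X, Y.Finite ∧ IsSeparatedDense (r : ℝ≥0∞) Y := by
  obtain ⟨N, -, hNfin, hN⟩ := Metric.exists_finite_isCover_of_isCompact (ε := r / 2)
    (by positivity) (isCompact_univ (X := X))
  -- Each ball of radius `r / 2` contains at most one point of an `r`-separated set, so a finite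
  -- cover bounds the packing number. A separated set of maximal cardinality is then dense, since a
  -- point far from it could be added.
  have htop : Metric.packingNumber r (univ : Set X) ≠ ⊤ := by
    have h := (Metric.packingNumber_two_mul_le_externalCoveringNumber (r / 2) univ).trans
      hN.externalCoveringNumber_le_encard
    rw [mul_div_cancel₀ _ (two_ne_zero' ℝ≥0)] at h
    exact (h.trans_lt hNfin.encard_lt_top).ne
  refine ⟨Metric.maximalSeparatedSet r univ, ?_, ?_, ?_⟩
  · rw [← encard_ne_top_iff, Metric.encard_maximalSeparatedSet htop]
    exact htop
  · intro y hy y' hy' hne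
    exact (Metric.isSeparated_maximalSeparatedSet hy hy' hne).le
  · intro x
    exact Metric.isCover_maximalSeparatedSet htop (mem_univ x)

/-- Voronoi tessellations exist. -/
lemma exists_isPartitionAtScale [CompactSpace X] [Nonempty X] [MeasurableSpace X] [BorelSpace X]
    {t : ℝ} (ht : 0 < t) : ∃ P : Set (Set X), IsPartitionAtScale t P := by
  obtain ⟨Y, hYfin, hY⟩ := exists_finite_isSeparatedDense (X := X) (r := (1 / t).toNNReal)
    (by simpa using ht)
  change IsSeparatedDense (ENNReal.ofReal (1 / t)) Y at hY
  obtain ⟨e, he⟩ := countable_iff_exists_injOn.1 hYfin.countable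
  let near : X → Set X := fun y => {x | ∀ z ∈ Y, edist x y ≤ edist x z}
  -- Ties go to the nearest centre with the smallest index `e`, which makes the cells disjoint.
  let cell : X → Set X := fun y => near y \ ⋃ z ∈ Y ∩ {z | e z < e y}, near z
  have hnear : ∀ y, MeasurableSet (near y) := fun y => by
    have : near y = ⋂ z ∈ Y, {x | edist x y ≤ edist x z} := by ext; simp [near]
    rw [this]
    exact (isClosed_biInter fun z _ => isClosed_le (by fun_prop) (by fun_prop)).measurableSet
  have hcell : ∀ y, MeasurableSet (cell y) := fun y =>
    (hnear y).diff (Finite.measurableSet_biUnion (hYfin.inter_of_left _) fun z _ => hnear z)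
  have huniq : ∀ x, ∀ y ∈ Y, ∀ y' ∈ Y, x ∈ cell y → x ∈ cell y' → y = y' := by
    intro x y hy y' hy' hxy hxy'
    refine he hy hy' (le_antisymm ?_ ?_) <;> by_contra! hlt
    · exact hxy.2 (mem_iUnion₂.2 ⟨y', ⟨hy', hlt⟩, hxy'.1⟩)
    · exact hxy'.2 (mem_iUnion₂.2 ⟨y, ⟨hy, hlt⟩, hxy.1⟩)
  have hexists : ∀ x, ∃ y ∈ Y, x ∈ cell y := by
    intro x
    have hYne : Y.Nonempty := (hY.dense x).imp fun y hy => hy.1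
    obtain ⟨y₀, hy₀, hmin₀⟩ := exists_min_image Y (edist x) hYfin hYne
    obtain ⟨y, hy, hmin⟩ := exists_min_image (Y ∩ {y | x ∈ near y}) e
      (hYfin.inter_of_left _) ⟨y₀, hy₀, hmin₀⟩
    refine ⟨y, hy.1, hy.2, fun h => ?_⟩
    obtain ⟨z, ⟨hz, hlt⟩, hxz⟩ := mem_iUnion₂.1 h
    exact absurd (hmin z ⟨hz, hxz⟩) (not_le.2 hlt)
  have hball : ∀ y ∈ Y, ∀ x, edist x y < ENNReal.ofReal (1 / (2 * t)) → x ∈ cell y := by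
    intro y hy x hx
    -- Within `1/(2t)` of `y` no other centre can be as near, as two such centres would be less than
    -- `1/t` apart. No tie occurs there.
    have hfar : ∀ z ∈ Y, y ≠ z → edist x y < edist x z := by
      intro z hz hne
      by_contra! hle
      refine absurd (hY.separated y hy z hz hne) (not_le.2 ?_)
      calc edist y z ≤ edist x y + edist x z := edist_triangle_left _ _ _
        _ < ENNReal.ofReal (1 / (2 * t)) + ENNReal.ofReal (1 / (2 * t)) :=
          ENNReal.add_lt_add hx (hle.trans_lt hx)
        _ = ENNReal.ofReal (1 / t) := by
          rw [← ENNReal.ofReal_add (by positivity) (by positivity)]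
          congr 1
          field_simp
          norm_num
    refine ⟨fun z hz => ?_, fun h => ?_⟩
    · rcases eq_or_ne y z with rfl | hne
      · exact le_rfl
      · exact (hfar z hz hne).le
    · obtain ⟨z, ⟨hz, hlt⟩, hxz⟩ := mem_iUnion₂.1 h
      exact absurd (hxz y hy) (not_le.2 (hfar z hz fun h => by simp [h] at hlt))
  have hself : ∀ y ∈ Y, y ∈ cell y := fun y hy =>
    hball y hy y (by rw [edist_self]; exact ENNReal.ofReal_pos.2 (by positivity))
  refine ⟨cell '' Y, ⟨⟨?_, ?_⟩, hYfin.image _, ?_⟩, Y, cell, hY, ?_, fun y hy => ⟨hball y hy, ?_⟩⟩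
  · rintro ⟨y, hy, h⟩
    exact notMem_empty y (h ▸ hself y hy)
  · intro x
    obtain ⟨y, hy, hxy⟩ := hexists x
    refine ⟨cell y, ⟨mem_image_of_mem _ hy, hxy⟩, ?_⟩
    rintro _ ⟨⟨y', hy', rfl⟩, hxy'⟩
    rw [huniq x y hy y' hy' hxy hxy']
  · rintro _ ⟨y, -, rfl⟩
    exact hcell y
  · refine InjOn.bijOn_image fun y hy y' hy' h => ?_
    exact huniq y y hy y' hy' (hself y hy) (h ▸ hself y hy)
  · intro x hx
    obtain ⟨z, hz, hxz⟩ := hY.dense x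
    exact (hx.1 z hz).trans hxz

end Tessellation

/-! ### Counting regions and choosing the scale -/

/-- The number of regions of a partition of a compact Riemannian manifold at scale `t` is
comparable to `t ^ d`. -/
lemma exists_ncard_isPartitionAtScale_bounds {d : ℕ}
    {M : Type*} [EMetricSpace M] [CompactSpace M] [Nonempty M] [MeasurableSpace M]
    [ChartedSpace (EuclideanSpace ℝ (Fin d)) M] [IsManifold (𝓡 d) 1 M]
    [Bundle.RiemannianBundle (fun x : M => TangentSpace (𝓡 d) x)]
    [IsContinuousRiemannianBundle (EuclideanSpace ℝ (Fin d))
      (fun x : M => TangentSpace (𝓡 d) x)]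
    [IsRiemannianManifold (𝓡 d) M] :
    ∃ a A : ℝ, 0 < a ∧ 0 ≤ A ∧ ∀ t : ℝ, 1 ≤ t → ∀ P : Set (Set M), IsPartitionAtScale t P →
      a * t ^ d ≤ (P.ncard : ℝ) ∧ (P.ncard : ℝ) ≤ A * t ^ d := by
  obtain ⟨A, hA, hupper⟩ := exists_card_le_of_separated (X := M)
      (E := EuclideanSpace ℝ (Fin d)) fun x => by
    obtain ⟨C, U, hU, h⟩ := exists_nhds_riemannianEDist_le_edist_extChartAt (𝓡 d) x
    refine ⟨extChartAt (𝓡 d) x, continuousAt_extChartAt x, C, U, hU, fun y hy z hz => ?_⟩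
    rw [IsRiemannianManifold.out (I := 𝓡 d) y z]
    exact h y hy z hz
  let x₀ : M := Classical.arbitrary M
  obtain ⟨C, U, hU, h⟩ := exists_nhds_edist_extChartAt_le_edist (𝓡 d) x₀
  obtain ⟨a, ha, hlower⟩ := exists_le_card_of_dense (f := extChartAt (𝓡 d) x₀)
    (fun V hV => extChartAt_image_nhds_mem_nhds_of_boundaryless hV) hU h
  rw [finrank_euclideanSpace_fin] at hupper hlower
  refine ⟨a, A, ha, hA, fun t ht P hP => ?_⟩
  obtain ⟨Y, cell, hY, hbij, -⟩ := hP.centred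
  have hfin : Y.Finite := hbij.finite_iff_finite.2 hP.measurablePartition.finite
  have hcard : P.ncard = hfin.toFinset.card := by
    rw [← hbij.image_eq, hbij.injOn.ncard_image, ncard_eq_toFinset_card _ hfin]
  rw [hcard]
  refine ⟨hlower t ht _ ?_, hupper t ht _ ?_⟩
  · simpa using hY.dense
  · simpa using hY.separated

theorem mainTheorem9 {d : ℕ} (hd : 1 ≤ d)
    {M : Type*} [EMetricSpace M] [CompactSpace M] [Nonempty M]
    [MeasurableSpace M] [BorelSpace M]
    [ChartedSpace (EuclideanSpace ℝ (Fin d)) M] [IsManifold (𝓡 d) ∞ M]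
    [Bundle.RiemannianBundle (fun x : M => TangentSpace (𝓡 d) x)]
    [IsContMDiffRiemannianBundle (𝓡 d) ∞ (EuclideanSpace ℝ (Fin d))
      (fun x : M => TangentSpace (𝓡 d) x)]
    [IsRiemannianManifold (𝓡 d) M] :
    ∃ C : ℝ, 0 < C ∧
      ∀ (Γ : Type*) [Group Γ] [MulAction Γ M] (S : Finset Γ),
        (∀ s ∈ S, s⁻¹ ∈ S) → Subgroup.closure (S : Set Γ) = ⊤ →
        (∀ γ : Γ, ∃ K : ℝ≥0, LipschitzWith K (fun x : M => γ • x)) →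
        ∀ N : ℕ, 1 ≤ N → ∃ t : ℝ, 1 ≤ t ∧
          Nonempty (ScaleGraph S (normalizedVolume d M) t) ∧
          ∀ G : ScaleGraph S (normalizedVolume d M) t,
            (N : ℝ) / C ≤ (G.order : ℝ) ∧ (G.order : ℝ) ≤ C * (N : ℝ) := by

  have : IsContinuousRiemannianBundle (EuclideanSpace ℝ (Fin d))
      (fun x : M => TangentSpace (𝓡 d) x) := by
    obtain ⟨g, g_smooth, hg⟩ := IsContMDiffRiemannianBundle.exists_contMDiff (IB := 𝓡 d) (n := ∞)
      (F := EuclideanSpace ℝ (Fin d)) (E := fun x : M => TangentSpace (𝓡 d) x)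
    exact ⟨g, g_smooth.continuous, hg⟩
  obtain ⟨a, A, ha, hA, hbounds⟩ := exists_ncard_isPartitionAtScale_bounds (d := d) (M := M)
  -- `a⁻¹` serves the lower bound and `A` the upper one; `a⁻¹` also makes the constant positive when
  -- `A = 0`.
  refine ⟨max a⁻¹ A, lt_max_of_lt_left (inv_pos.2 ha), ?_⟩
  intro Γ _ _ S _ _ _ N hN
  have hN1 : (1 : ℝ) ≤ N := by exact_mod_cast hN
  have ht : 1 ≤ (N : ℝ) ^ (d : ℝ)⁻¹ := Real.one_le_rpow hN1 (by positivity)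
  -- This is where `d ≥ 1` is needed: in dimension `0` the count could not grow with `N`.
  have htd : ((N : ℝ) ^ (d : ℝ)⁻¹) ^ d = N := Real.rpow_inv_natCast_pow (by positivity) (by omega)
  refine ⟨(N : ℝ) ^ (d : ℝ)⁻¹, ht, ?_, fun G => ?_⟩
  · obtain ⟨P, hP⟩ := exists_isPartitionAtScale (X := M) (zero_lt_one.trans_le ht)
    exact ⟨⟨P, hP, _, rfl⟩⟩
  · obtain ⟨h1, h2⟩ := hbounds _ ht G.regions G.isPartitionAtScale
    rw [htd] at h1 h2
    change _ ≤ (G.regions.ncard : ℝ) ∧ (G.regions.ncard : ℝ) ≤ _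
    constructor
    · refine le_trans ?_ h1
      rw [div_le_iff₀ (lt_max_of_lt_left (inv_pos.2 ha))]
      calc (N : ℝ) = a * N * a⁻¹ := by field_simp
        _ ≤ a * N * max a⁻¹ A := by gcongr; exact le_max_left _ _
    · exact h2.trans (by gcongr; exact le_max_right _ _)
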